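/- Notation: $(A)_m=\prod_{i=0}^{m-1}(1-Aq^i)$ and $(A)_\infty=\prod_{i\ge 0}(1-Aq^i)$ (as formal power series in $q$), and $\left[{a\atop b}\right]=\frac{(q)_a}{(q)_b(q)_{a-b}}$ if $0\le b\le a$, and $0$ otherwise. For $j\ge 1$ and $n\ge 0$ let $\mathrm{Spt}_j(n)$ be the coefficient of $q^n$ in $$\sum_{n_{j}\geq 1}\ \sum_{n_{j-1}\geq\cdots\geq n_{1}\geq 0}\frac{q^{n_{j}}}{(1-q^{n_{j}})^2(q^{n_{j}+1})_{\infty}}\left[{n_{j}\atop n_{j-1}}\right]\cdots \left[{n_{2}\atop n_{1}}\right]q^{n_{1}^{2}+\cdots+n_{j-1}^{2}}.$$ Let $\pi$ be a partition, with Ferrers diagram drawn with the largest part on top. The lower-Durfee square of $\pi$ is the largest square that fits inside the diagram starting from its lower left corner. The successive lower-Durfee squares of $\pi$ are obtained by repeating this with the parts above the squares already taken, as long as such parts exist. The occurrences of each part size in $\pi$ are marked $1,2,3,\ldots$ from top to bottom (i.e. from left to right when the parts are written in weakly decreasing order). The weight $W_j(\pi)$ is the sum of the marks of all parts lying in the first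 $j-1$ successive lower-Durfee squares of $\pi$, plus the mark of the part directly above the $(j-1)$st square if such a part exists (for $j=1$: the mark of the smallest part); if $\pi$ has fewer than $j-1$ successive lower-Durfee squares, $W_j(\pi)$ is the sum of the marks of all parts of $\pi$. **Theorem 3.1.** For all $j\ge 1$ and $n\ge 0$, $$\mathrm{Spt}_j(n)=\sum_{\pi} W_j(\pi),$$ where the sum is over all partitions $\pi$ of $n$. Moreover, $\mathrm{Spt}_1(n)=\mathrm{spt}(n)$ for all $n\ge 0$, where $\mathrm{spt}(n)$ is the total number of appearances of the smallest parts in all the partitions of $n$ (with $\mathrm{spt}(0)=0$). -/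

import Mathlib

open scoped PowerSeries PowerSeries.WithPiTopology

namespace LowerDurfee

/-! ### The generating function of `Spt_j`

All `q`-series are formal power series in `q = X` over `ℚ`, with coefficientwise convergence. -/

noncomputable section

/-- `(A; q)_n = (1 - A)(1 - A q) ⋯ (1 - A q^(n-1))`. -/
def qPoch (A : ℚ⟦X⟧) (n : ℕ) : ℚ⟦X⟧ :=
  ∏ i ∈ Finset.range n, (1 - A * PowerSeries.X ^ i)

/-- `(A; q)_∞ = (1 - A)(1 - A q)(1 - A q²) ⋯`. -/
def qPochInf (A : ℚ⟦X⟧) : ℚ⟦X⟧ :=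
  ∏' i : ℕ, (1 - A * PowerSeries.X ^ i)

/-- The Gaussian binomial coefficient `[n, m]`, equal to `(q)_n / ((q)_m (q)_(n-m))` for
`0 ≤ m ≤ n` and to `0` otherwise. -/
def qBinom (n m : ℕ) : ℚ⟦X⟧ :=
  if m ≤ n then
    qPoch PowerSeries.X n * (qPoch PowerSeries.X m * qPoch PowerSeries.X (n - m))⁻¹
  else 0

/-- The summand belonging to `n_j = N` and `(n_1, …, n_{j-1}) = (ν 0, …, ν (k-1))`, with
`k = j - 1`:
`q^N / ((1 - q^N)² (q^(N+1); q)_∞) · [n_j, n_{j-1}] ⋯ [n_2, n_1] · q^(n_1² + ⋯ + n_{j-1}²)`.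
The tuple `Fin.snoc ν N` is `(n_1, …, n_{j-1}, n_j)`. -/
def sptTerm {k : ℕ} (N : ℕ) (ν : Fin k → ℕ) : ℚ⟦X⟧ :=
  PowerSeries.X ^ N *
    ((1 - PowerSeries.X ^ N) ^ 2 * qPochInf (PowerSeries.X ^ (N + 1)))⁻¹ *
    (∏ i : Fin k,
      qBinom ((Fin.snoc ν N : Fin (k + 1) → ℕ) i.succ)
        ((Fin.snoc ν N : Fin (k + 1) → ℕ) i.castSucc)) *
    PowerSeries.X ^ (∑ i : Fin k, ν i ^ 2)

/-- The indices of the summation: `n_j ≥ 1` and `n_{j-1} ≥ ⋯ ≥ n_1 ≥ 0`. -/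
abbrev SptIndex (k : ℕ) : Type :=
  {p : ℕ × (Fin k → ℕ) // 1 ≤ p.1 ∧ Monotone p.2}

/-- The generating function `∑ Spt_j(n) q^n`, for `j ≥ 1`. -/
def sptSeries (j : ℕ) : ℚ⟦X⟧ :=
  ∑' p : SptIndex (j - 1), sptTerm p.1.1 p.1.2

/-- `Spt_j(n)`, for `j ≥ 1`. -/
def Spt (j n : ℕ) : ℚ :=
  PowerSeries.coeff n (sptSeries j)

/-! The infinite product and the infinite sum above converge, and the power series inverted in
them have non-zero constant coefficient. -/

theorem multipliable_qPochInf (N : ℕ) :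
    Multipliable fun i : ℕ => (1 - PowerSeries.X ^ (N + 1) * PowerSeries.X ^ i : ℚ⟦X⟧) := by
  have h := PowerSeries.WithPiTopology.multipliable_one_add_of_tendsto_order_atTop_nhds_top
    (R := ℚ) (f := fun i : ℕ => -(PowerSeries.X ^ (N + 1) * PowerSeries.X ^ i : ℚ⟦X⟧)) ?_
  · simpa [sub_eq_add_neg] using h
  · refine ENat.tendsto_nhds_top_iff_natCast_lt.mpr fun n => ?_
    filter_upwards [Filter.eventually_ge_atTop n] with i hi
    rw [PowerSeries.order_neg, ← pow_add, PowerSeries.order_X_pow]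
    exact_mod_cast (by omega : n < N + 1 + i)

theorem constantCoeff_qPochInf (N : ℕ) :
    PowerSeries.constantCoeff (qPochInf (PowerSeries.X ^ (N + 1))) = 1 := by
  rw [qPochInf, (multipliable_qPochInf N).map_tprod _
    (PowerSeries.WithPiTopology.continuous_constantCoeff ℚ)]
  simp

theorem constantCoeff_qPoch (n : ℕ) :
    PowerSeries.constantCoeff (qPoch PowerSeries.X n) = 1 := by
  simp [qPoch, map_prod]

theorem summable_sptTerm (k : ℕ) :
    Summable fun p : SptIndex k => sptTerm p.1.1 p.1.2 := by
  rw [PowerSeries.WithPiTopology.summable_iff_summable_coeff]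
  intro n
  refine summable_of_hasFiniteSupport ?_
  refine Set.Finite.subset
    (Set.Finite.preimage (f := fun p : SptIndex k => p.1) Subtype.val_injective.injOn
      ((Set.finite_Iic n).prod (Set.Finite.pi fun _ : Fin k => Set.finite_Iic n))) ?_
  rintro ⟨⟨N, ν⟩, h1, h2⟩ hp
  have hN : N ≤ n := by
    by_contra hlt
    refine hp ?_
    simp only [sptTerm, mul_assoc]
    rw [PowerSeries.coeff_X_pow_mul', if_neg hlt]
  have hmono : Monotone (Fin.snoc ν N : Fin (k + 1) → ℕ) := by
    rw [Fin.monotone_iff_le_succ]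
    intro i
    by_contra hlt
    refine hp ?_
    have h0 : (∏ i : Fin k,
      qBinom ((Fin.snoc ν N : Fin (k + 1) → ℕ) i.succ)
        ((Fin.snoc ν N : Fin (k + 1) → ℕ) i.castSucc)) = 0 :=
      Finset.prod_eq_zero (Finset.mem_univ i) (if_neg hlt)
    simp only [sptTerm, h0, mul_zero, zero_mul, map_zero]
  refine ⟨hN, fun i _ => ?_⟩
  have h3 := hmono (Fin.le_last i.castSucc)
  rw [Fin.snoc_castSucc, Fin.snoc_last] at h3
  exact le_trans h3 hN

end

/-! ### Lower-Durfee squares, marks and weights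

A Ferrers diagram is given by the list `l` of its rows from bottom to top, that is, by the parts
in weakly increasing order. -/

/-- The parts of a partition from bottom to top of its Ferrers diagram (increasing order). -/
def rows {n : ℕ} (π : n.Partition) : List ℕ :=
  π.parts.sort (· ≤ ·)

/-- The side of the lower-Durfee square: the largest `d` such that a `d × d` square fits into the
diagram at its lower left corner, i.e. there are at least `d` rows and each of the `d` lowest rows
has length at least `d`. It is `0` exactly for the empty diagram (if all rows are non-empty). -/
def lowerDurfeeSide (l : List ℕ) : ℕ :=
  Nat.findGreatest (fun d => ∀ x ∈ l.take d, d ≤ x) l.length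

/-- The rows that remain above the first `s` successive lower-Durfee squares. -/
def rowsAbove (l : List ℕ) : ℕ → List ℕ
  | 0 => l
  | s + 1 => (rowsAbove l s).drop (lowerDurfeeSide (rowsAbove l s))

/-- The number of rows meeting the first `s` successive lower-Durfee squares. If there are fewer
than `s` such squares, then these are all the rows. -/
def rowsInSquares (l : List ℕ) (s : ℕ) : ℕ :=
  ∑ i ∈ Finset.range s, lowerDurfeeSide (rowsAbove l i)

/-- The mark of the `i`-th row from the bottom, `i = 0, 1, …`. Equal parts are marked `1, 2, 3, …`
from the top of the diagram to the bottom (from left to right when the parts are written in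
decreasing order), so the mark counts the equal parts among this row and the rows above it. -/
def mark (l : List ℕ) (i : ℕ) : ℕ :=
  (l.drop i).count (l.getD i 0)

/-- The weight `W_j(π)`, `j ≥ 1`: the sum of the marks of all parts in the first `j - 1`
successive lower-Durfee squares and of the part right above them, if there is one (of all parts,
if there are fewer than `j - 1` such squares). -/
def W (j : ℕ) {n : ℕ} (π : n.Partition) : ℕ :=
  ∑ i ∈ Finset.range (min (rowsInSquares (rows π) (j - 1) + 1) (rows π).length),
    mark (rows π) i

/-- Andrews' `spt(n)`: the total number of appearances of the smallest parts in all the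
partitions of `n`. -/
noncomputable def spt (n : ℕ) : ℕ :=
  ∑ π : n.Partition, π.parts.count (sInf {x | x ∈ π.parts})

end LowerDurfee

/-!
A summand of `∑ Spt_j(n) q^n` is a product of `q`-series each of which counts sorted lists of rows
of a Ferrers diagram. The factor `[m, a] q^(a²)` counts the weakly increasing lists of `a` rows with
lengths in `[a, m]` (`listGF_box_square`), and the factor
`q^N / ((1 - q^N)² (q^(N+1))_∞)` counts the lists with smallest row `N`, weighted by the number of
occurrences of `N` (`listGF_headCount`). Since the upper bound for the row lengths of one block is
the lower bound for those of the next, stacking the blocks of `n_1, …, n_{j-1}` rows and the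
remaining rows gives a partition. Hence a summand counts partitions whose lowest
`s = n_1 + ⋯ + n_{j-1}` rows are cut into blocks in this way (`chain`), each weighted by the mark of
the row directly above them (`sptTerm_eq_listGF`, `termWeight_eq_mark`).

It remains to see for which `s` the lowest `s` rows can be cut into blocks, and in how many ways.
Write the rows from the bottom as `l 0 ≤ l 1 ≤ ⋯` and let the last block lie on top of `t` rows, so
that it has `s - t` rows. It must satisfy `l (t - 1) ≤ s - t ≤ l t`, which means
`(t - 1) + l (t - 1) < s ≤ t + l t`. As `t + l t` is strictly increasing, `t` is determined by `s`
(`chain_unique`), and `t ≤ D` is equivalent to `s ≤ D + l D`. Capped at the number of rows,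
`D + l D` is the number of rows in one more lower-Durfee square on top of `D` rows. So the
admissible `s` are exactly those not exceeding the number of rows in the first `j - 1` successive
lower-Durfee squares (`le_rowsInSquares_of_mem_chain`, `exists_mem_chain`), and summing the marks of the
rows `s` gives `W_j`.
-/

namespace LowerDurfee

/-! ### Generating functions of weighted lists -/

/-- The finitely many lists of positive integers with sum `n`, in any order. -/
def posLists (n : ℕ) : Finset (List ℕ) :=
  Finset.univ.image fun c : Composition n => c.blocks

theorem mem_posLists {n : ℕ} {l : List ℕ} :
    l ∈ posLists n ↔ (∀ x ∈ l, 0 < x) ∧ l.sum = n := by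
  simp only [posLists, Finset.mem_image, Finset.mem_univ, true_and]
  constructor
  · rintro ⟨c, rfl⟩
    exact ⟨fun x hx => c.blocks_pos hx, c.blocks_sum⟩
  · rintro ⟨h1, h2⟩
    exact ⟨⟨l, fun {i} hi => h1 i hi, h2⟩, rfl⟩

/-- The generating function `∑ w(l) q^(sum of l)` over all lists `l` of positive integers. The
lists are not required to be sorted: sortedness is imposed by the vanishing of `w`. -/
noncomputable def listGF (w : List ℕ → ℚ) : ℚ⟦X⟧ :=
  PowerSeries.mk fun n => ∑ l ∈ posLists n, w l

theorem coeff_listGF (w : List ℕ → ℚ) (n : ℕ) :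
    PowerSeries.coeff n (listGF w) = ∑ l ∈ posLists n, w l := by
  simp [listGF]

theorem listGF_congr {w w' : List ℕ → ℚ} (h : ∀ l, (∀ x ∈ l, 0 < x) → w l = w' l) :
    listGF w = listGF w' := by
  ext n
  rw [coeff_listGF, coeff_listGF]
  exact Finset.sum_congr rfl fun l hl => h l (mem_posLists.mp hl).1

theorem listGF_add (w w' : List ℕ → ℚ) :
    listGF (fun l => w l + w' l) = listGF w + listGF w' := by
  ext n
  simp [coeff_listGF, Finset.sum_add_distrib]

theorem listGF_zero : listGF (fun _ => 0) = 0 := by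
  ext n
  simp [coeff_listGF]

/-- Concatenation of lists corresponds to the product of generating functions. As `w₁` only sees
lists of length `a`, the place where a list has to be cut is known. -/
theorem listGF_mul {w₁ w₂ : List ℕ → ℚ} {a : ℕ} (h : ∀ l, w₁ l ≠ 0 → l.length = a) :
    listGF (fun l => w₁ (l.take a) * w₂ (l.drop a)) = listGF w₁ * listGF w₂ := by
  ext n
  rw [coeff_listGF, PowerSeries.coeff_mul]
  simp only [coeff_listGF, Finset.sum_mul_sum, ← Finset.sum_product']
  rw [Finset.sum_sigma']
  refine Finset.sum_bij_ne_zero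
    (fun l _ _ => ⟨((l.take a).sum, (l.drop a).sum), (l.take a, l.drop a)⟩) ?_ ?_ ?_ ?_
  · intro l hl _
    rw [mem_posLists] at hl
    simp only [Finset.mem_sigma, Finset.mem_product, mem_posLists, and_true]
    refine ⟨Finset.HasAntidiagonal.mem_antidiagonal.mpr ?_,
      fun x hx => hl.1 x (List.mem_of_mem_take hx), fun x hx => hl.1 x (List.mem_of_mem_drop hx)⟩
    change (l.take a).sum + (l.drop a).sum = n
    rw [← List.sum_append, List.take_append_drop, hl.2]
  · intro l _ _ l' _ _ he
    simp only [Sigma.mk.injEq, heq_eq_eq, Prod.mk.injEq] at he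
    rw [← List.take_append_drop a l, he.2.1, he.2.2, List.take_append_drop]
  · rintro ⟨⟨s, t⟩, x, y⟩ hm hne
    simp only [Finset.mem_sigma, Finset.mem_product, mem_posLists] at hm
    obtain ⟨hst, ⟨hx, rfl⟩, hy, rfl⟩ := hm
    replace hst : x.sum + y.sum = n := Finset.HasAntidiagonal.mem_antidiagonal.mp hst
    have hlen : x.length = a := h x (left_ne_zero_of_mul hne)
    have ht : (x ++ y).take a = x := by simp [← hlen]
    have hd : (x ++ y).drop a = y := by simp [← hlen]
    refine ⟨x ++ y, ?_, ?_, ?_⟩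
    · rw [mem_posLists]
      refine ⟨fun z hz => ?_, by rw [List.sum_append, hst]⟩
      rcases List.mem_append.mp hz with hz | hz
      exacts [hx z hz, hy z hz]
    · rw [ht, hd]
      exact hne
    · rw [ht, hd]
  · intro l _ _
    rfl

/-- The indicator function of a set of lists, as a weight. -/
noncomputable def ind (S : Set (List ℕ)) (l : List ℕ) : ℚ :=
  open Classical in if l ∈ S then 1 else 0

theorem ind_of_mem {S : Set (List ℕ)} {l : List ℕ} (h : l ∈ S) : ind S l = 1 := by
  simp [ind, h]

theorem ind_of_notMem {S : Set (List ℕ)} {l : List ℕ} (h : l ∉ S) : ind S l = 0 := by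
  simp [ind, h]

theorem mem_of_ind_ne_zero {S : Set (List ℕ)} {l : List ℕ} (h : ind S l ≠ 0) : l ∈ S := by
  by_contra hl
  exact h (ind_of_notMem hl)

theorem ind_congr {S S' : Set (List ℕ)} {l l' : List ℕ} (h : l ∈ S ↔ l' ∈ S') :
    ind S l = ind S' l' := by
  by_cases hl : l ∈ S
  · rw [ind_of_mem hl, ind_of_mem (h.mp hl)]
  · rw [ind_of_notMem hl, ind_of_notMem (mt h.mpr hl)]

theorem listGF_ind_singleton {l : List ℕ} (hl : ∀ x ∈ l, 0 < x) :
    listGF (ind {l}) = PowerSeries.X ^ l.sum := by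
  ext n
  rw [coeff_listGF, PowerSeries.coeff_X_pow]
  split_ifs with h
  · rw [Finset.sum_eq_single_of_mem l (mem_posLists.mpr ⟨hl, h.symm⟩)]
    · exact ind_of_mem rfl
    · exact fun l' _ hne => ind_of_notMem hne
  · refine Finset.sum_eq_zero fun l' hl' => ind_of_notMem ?_
    rintro rfl
    exact h (mem_posLists.mp hl').2.symm

/-- The weight `w` of the tail for lists with first entry `N`, and `0` for all other lists. -/
def consW (N : ℕ) (w : List ℕ → ℚ) : List ℕ → ℚ
  | [] => 0
  | x :: l => if x = N then w l else 0

theorem consW_cons (N x : ℕ) (w : List ℕ → ℚ) (l : List ℕ) :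
    consW N w (x :: l) = if x = N then w l else 0 :=
  rfl

theorem listGF_consW {N : ℕ} (hN : 1 ≤ N) (w : List ℕ → ℚ) :
    listGF (consW N w) = PowerSeries.X ^ N * listGF w := by
  have h : listGF (ind {[N]}) = PowerSeries.X ^ N := by
    rw [listGF_ind_singleton (by simpa using Nat.pos_of_ne_zero (by omega))]
    simp
  rw [← h, ← listGF_mul (a := 1) fun l hl => by rw [mem_of_ind_ne_zero hl]; rfl]
  congr 1
  funext l
  cases l with
  | nil => simp [consW, ind]
  | cons x l =>
    by_cases hx : x = N
    · simp [consW, ind, hx]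
    · simp [consW, ind, hx]

/-! ### Lists in a box and Gaussian binomial coefficients -/

/-- The weakly increasing lists of length `a` with all entries in `[lo, hi]`. -/
def box (a lo hi : ℕ) : Set (List ℕ) :=
  {l | l.Pairwise (· ≤ ·) ∧ l.length = a ∧ ∀ x ∈ l, lo ≤ x ∧ x ≤ hi}

theorem box_zero (lo hi : ℕ) : box 0 lo hi = {[]} := by
  ext l
  simp only [box, Set.mem_ofPred_eq, Set.mem_singleton_iff, List.length_eq_zero_iff]
  constructor
  · exact fun h => h.2.1
  · rintro rfl
    simp

theorem box_eq_empty {a lo hi : ℕ} (ha : a ≠ 0) (h : hi < lo) : box a lo hi = ∅ := by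
  rw [Set.eq_empty_iff_forall_notMem]
  rintro l ⟨_, hlen, hl⟩
  obtain ⟨x, hx⟩ := List.exists_mem_of_length_pos (l := l) (by omega)
  have := hl x hx
  omega

theorem listGF_box_zero (lo hi : ℕ) : listGF (ind (box 0 lo hi)) = 1 := by
  rw [box_zero, listGF_ind_singleton (by simp)]
  simp

theorem listGF_box_eq_zero {a lo hi : ℕ} (ha : a ≠ 0) (h : hi < lo) :
    listGF (ind (box a lo hi)) = 0 := by
  rw [box_eq_empty ha h, ← listGF_zero]
  congr 1
  funext l
  exact ind_of_notMem (Set.notMem_empty l)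

theorem cons_mem_box {x a lo hi : ℕ} {l : List ℕ} :
    x :: l ∈ box (a + 1) lo hi ↔ (lo ≤ x ∧ x ≤ hi) ∧ l ∈ box a x hi := by
  simp only [box, Set.mem_ofPred_eq, List.pairwise_cons, List.length_cons, List.mem_cons,
    forall_eq_or_imp]
  constructor
  · rintro ⟨⟨h1, h2⟩, h3, h4, h5⟩
    exact ⟨h4, h2, by omega, fun y hy => ⟨h1 y hy, (h5 y hy).2⟩⟩
  · rintro ⟨h4, h2, h3, h5⟩
    exact ⟨⟨fun y hy => (h5 y hy).1, h2⟩, by omega, h4,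
      fun y hy => ⟨h4.1.trans (h5 y hy).1, (h5 y hy).2⟩⟩

/-- The recursion according to whether or not the first entry is the smallest one allowed. -/
theorem listGF_box_succ {a lo hi : ℕ} (hlo : 1 ≤ lo) (h : lo ≤ hi) :
    listGF (ind (box (a + 1) lo hi)) =
      PowerSeries.X ^ lo * listGF (ind (box a lo hi)) +
        listGF (ind (box (a + 1) (lo + 1) hi)) := by
  rw [← listGF_consW hlo, ← listGF_add]
  congr 1
  funext l
  cases l with
  | nil => simp [consW, ind, box]
  | cons x l =>
    rw [consW_cons]
    split_ifs with hx
    · subst hx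
      rw [ind_of_notMem (S := box (a + 1) (x + 1) hi) (by simp [cons_mem_box]), add_zero]
      exact ind_congr (by simp [cons_mem_box, h])
    · have : lo ≤ x ↔ lo + 1 ≤ x := by omega
      rw [zero_add]
      exact ind_congr (by simp [cons_mem_box, this])

theorem qPoch_succ (n : ℕ) :
    qPoch PowerSeries.X (n + 1) = qPoch PowerSeries.X n * (1 - PowerSeries.X ^ (n + 1)) := by
  rw [qPoch, qPoch, Finset.prod_range_succ, pow_succ']

theorem qPoch_ne_zero (n : ℕ) : qPoch PowerSeries.X n ≠ 0 := by
  intro h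
  have := constantCoeff_qPoch n
  rw [h] at this
  simp at this

theorem qBinom_mul (r a : ℕ) :
    qBinom (r + a) a * (qPoch PowerSeries.X a * qPoch PowerSeries.X r) =
      qPoch PowerSeries.X (r + a) := by
  rw [qBinom, if_pos (by omega), Nat.add_sub_cancel, mul_assoc, PowerSeries.inv_mul_cancel,
    mul_one]
  simp [constantCoeff_qPoch]

theorem qBinom_zero_right (r : ℕ) : qBinom r 0 = 1 := by
  have h := qBinom_mul r 0
  refine mul_right_cancel₀ (qPoch_ne_zero r) ?_
  simpa [qPoch] using h

theorem qBinom_self (a : ℕ) : qBinom a a = 1 := by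
  have h := qBinom_mul 0 a
  refine mul_right_cancel₀ (qPoch_ne_zero a) ?_
  simpa [qPoch] using h

/-- The `q`-Pascal recursion. -/
theorem qBinom_pascal (r a : ℕ) :
    qBinom (r + 1 + (a + 1)) (a + 1) =
      qBinom (r + 1 + a) a + PowerSeries.X ^ (a + 1) * qBinom (r + (a + 1)) (a + 1) := by
  refine mul_right_cancel₀ (mul_ne_zero (qPoch_ne_zero (a + 1)) (qPoch_ne_zero (r + 1))) ?_
  rw [qBinom_mul]
  have h1 := qBinom_mul (r + 1) a
  have h2 := qBinom_mul r (a + 1)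
  rw [show r + 1 + (a + 1) = r + a + 1 + 1 by ring, qPoch_succ (r + a + 1)]
  rw [show r + 1 + a = r + a + 1 by ring] at h1 ⊢
  rw [show r + (a + 1) = r + a + 1 by ring] at h2 ⊢
  rw [qPoch_succ a] at h2 ⊢
  rw [qPoch_succ r] at h1 ⊢
  linear_combination (-(1 - PowerSeries.X ^ (a + 1))) * h1 -
    PowerSeries.X ^ (a + 1) * (1 - PowerSeries.X ^ (r + 1)) * h2

theorem listGF_box (r a lo : ℕ) (hlo : 1 ≤ lo) :
    listGF (ind (box a lo (lo + r))) = PowerSeries.X ^ (a * lo) * qBinom (r + a) a := by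
  induction r generalizing a lo with
  | zero =>
    rw [zero_add, qBinom_self, mul_one]
    induction a with
    | zero => rw [listGF_box_zero, zero_mul, pow_zero]
    | succ a ih =>
      rw [listGF_box_succ hlo (by omega), ih, listGF_box_eq_zero (by omega) (by omega)]
      ring
  | succ r ihr =>
    induction a with
    | zero => rw [listGF_box_zero, zero_mul, pow_zero, qBinom_zero_right, mul_one]
    | succ a ih =>
      have h := ihr (a + 1) (lo + 1) (by omega)
      rw [show lo + 1 + r = lo + (r + 1) by ring] at h
      rw [listGF_box_succ hlo (by omega), ih, h, qBinom_pascal]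
      ring

/-- Here `q^(a²)` accounts for the square, and the Gaussian binomial coefficient for the cells to
its right. -/
theorem listGF_box_square (a m : ℕ) :
    listGF (ind (box a a m)) = qBinom m a * PowerSeries.X ^ (a ^ 2) := by
  rcases Nat.eq_zero_or_pos a with rfl | ha
  · rw [listGF_box_zero, qBinom_zero_right]
    simp
  · rcases le_or_gt a m with h | h
    · obtain ⟨r, rfl⟩ := Nat.exists_eq_add_of_le h
      rw [listGF_box r a a ha, add_comm r a, sq, mul_comm]
    · rw [listGF_box_eq_zero (by omega) h, qBinom, if_neg (by omega), zero_mul]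

/-! ### Lists with a marked smallest entry -/

/-- The weakly increasing lists with all entries at least `N`. -/
def sortedGE (N : ℕ) : Set (List ℕ) :=
  {l | l.Pairwise (· ≤ ·) ∧ ∀ x ∈ l, N ≤ x}

theorem cons_mem_sortedGE {x N : ℕ} {l : List ℕ} :
    x :: l ∈ sortedGE N ↔ N ≤ x ∧ l ∈ sortedGE x := by
  simp only [sortedGE, Set.mem_ofPred_eq, List.pairwise_cons, List.mem_cons, forall_eq_or_imp]
  constructor
  · rintro ⟨⟨h1, h2⟩, h3, h4⟩
    exact ⟨h3, h2, h1⟩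
  · rintro ⟨h3, h2, h1⟩
    exact ⟨⟨h1, h2⟩, h3, fun y hy => h3.trans (h1 y hy)⟩

theorem nil_mem_sortedGE (N : ℕ) : [] ∈ sortedGE N := by
  simp [sortedGE]

theorem listGF_sortedGE {N : ℕ} (hN : 1 ≤ N) :
    listGF (ind (sortedGE N)) * (1 - PowerSeries.X ^ N) = listGF (ind (sortedGE (N + 1))) := by
  have h : listGF (ind (sortedGE N)) = PowerSeries.X ^ N * listGF (ind (sortedGE N)) +
      listGF (ind (sortedGE (N + 1))) := by
    rw [← listGF_consW hN, ← listGF_add]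
    congr 1
    funext l
    cases l with
    | nil => simp [consW, ind, nil_mem_sortedGE]
    | cons x l =>
      rw [consW_cons]
      split_ifs with hx
      · subst hx
        rw [ind_of_notMem (S := sortedGE (x + 1)) (by simp [cons_mem_sortedGE]), add_zero]
        exact ind_congr (by simp [cons_mem_sortedGE])
      · have : N ≤ x ↔ N + 1 ≤ x := by omega
        rw [zero_add]
        exact ind_congr (by simp [cons_mem_sortedGE, this])
  linear_combination h

theorem listGF_sortedGE_mul_prod (N n : ℕ) :
    listGF (ind (sortedGE (N + 1))) *
        ∏ i ∈ Finset.range n, (1 - PowerSeries.X ^ (N + 1) * PowerSeries.X ^ i) =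
      listGF (ind (sortedGE (N + n + 1))) := by
  induction n with
  | zero => simp
  | succ n ih =>
    rw [Finset.prod_range_succ, ← mul_assoc, ih, ← pow_add,
      show N + 1 + n = N + n + 1 by ring, listGF_sortedGE (by omega)]
    rfl

theorem coeff_listGF_sortedGE {n N : ℕ} (h : n < N) :
    PowerSeries.coeff n (listGF (ind (sortedGE N))) = PowerSeries.coeff n 1 := by
  rw [← listGF_box_zero 0 0, box_zero, coeff_listGF, coeff_listGF]
  refine Finset.sum_congr rfl fun l hl => ?_
  rw [mem_posLists] at hl
  cases l with
  | nil => rw [ind_of_mem (nil_mem_sortedGE N), ind_of_mem (Set.mem_singleton _)]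
  | cons x l =>
    rw [ind_of_notMem (S := {[]}) (by simp), ind_of_notMem]
    rw [cons_mem_sortedGE]
    rintro ⟨hx, -⟩
    have := hl.2
    rw [List.sum_cons] at this
    omega

theorem listGF_sortedGE_mul_qPochInf (N : ℕ) :
    listGF (ind (sortedGE (N + 1))) * qPochInf (PowerSeries.X ^ (N + 1)) = 1 := by
  have h1 := ((multipliable_qPochInf N).tendsto_prod_tprod_nat).const_mul
    (listGF (ind (sortedGE (N + 1))))
  simp only [listGF_sortedGE_mul_prod] at h1
  refine tendsto_nhds_unique h1 ?_
  rw [PowerSeries.WithPiTopology.tendsto_iff_coeff_tendsto]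
  intro d
  refine tendsto_const_nhds.congr' ?_
  filter_upwards [Filter.eventually_ge_atTop d] with n hn
  exact (coeff_listGF_sortedGE (by omega)).symm

/-- The number of occurrences of `N`, for weakly increasing lists with first entry `N`. -/
noncomputable def headCount (N : ℕ) (l : List ℕ) : ℚ :=
  consW N (fun l' => ind (sortedGE N) l' * ((N :: l').count N : ℚ)) l

theorem headCount_cons_self {N : ℕ} {l : List ℕ} (h : l ∈ sortedGE N) :
    headCount N (N :: l) = ((N :: l).count N : ℚ) := by
  simp [headCount, consW, ind_of_mem h]

theorem headCount_ne_zero {N : ℕ} {l : List ℕ} (h : headCount N l ≠ 0) :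
    ∃ l', l = N :: l' ∧ l' ∈ sortedGE N := by
  cases l with
  | nil => simp [headCount, consW] at h
  | cons x l =>
    simp only [headCount, consW] at h
    split_ifs at h with hx
    · exact ⟨l, by rw [hx], mem_of_ind_ne_zero (left_ne_zero_of_mul h)⟩
    · exact absurd rfl h

theorem headCount_cons {N : ℕ} (x : ℕ) (l : List ℕ) :
    headCount N (x :: l) = consW N (fun l' => ind (sortedGE N) l' + headCount N l') (x :: l) := by
  rw [headCount, consW_cons, consW_cons]
  split_ifs with hx
  · by_cases h : l ∈ sortedGE N
    · rw [ind_of_mem h]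
      cases l with
      | nil => simp [headCount, consW]
      | cons y l =>
        rw [cons_mem_sortedGE] at h
        by_cases hy : y = N
        · subst hy
          rw [headCount, consW_cons, if_pos rfl, ind_of_mem h.2, List.count_cons_self]
          push_cast
          ring
        · have h0 : (y :: l).count N = 0 := by
            rw [List.count_eq_zero, List.mem_cons]
            rintro (h1 | h1)
            · exact hy h1.symm
            · have := h.2.2 N h1
              omega
          rw [headCount, consW_cons, if_neg hy, List.count_cons_self, h0]
          norm_num
    · rw [ind_of_notMem h]
      cases l with
      | nil => exact absurd (nil_mem_sortedGE N) h
      | cons y l =>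
        by_cases hy : y = N
        · subst hy
          rw [headCount, consW_cons, if_pos rfl, ind_of_notMem]
          · simp
          · exact fun h' => h (cons_mem_sortedGE.mpr ⟨le_rfl, h'⟩)
        · simp [headCount, consW, hy]
  · rfl

/-- The factor of `sptTerm` in front of the Gaussian binomial coefficients. -/
theorem listGF_headCount {N : ℕ} (hN : 1 ≤ N) :
    listGF (headCount N) = PowerSeries.X ^ N *
      ((1 - PowerSeries.X ^ N) ^ 2 * qPochInf (PowerSeries.X ^ (N + 1)))⁻¹ := by
  rw [PowerSeries.eq_mul_inv_iff_mul_eq]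
  · have h : listGF (headCount N) =
        PowerSeries.X ^ N * (listGF (ind (sortedGE N)) + listGF (headCount N)) := by
      rw [← listGF_add, ← listGF_consW hN]
      congr 1
      funext l
      cases l with
      | nil => rfl
      | cons x l => exact headCount_cons x l
    have h1 := listGF_sortedGE hN
    have h2 := listGF_sortedGE_mul_qPochInf N
    linear_combination (1 - PowerSeries.X ^ N) * qPochInf (PowerSeries.X ^ (N + 1)) * h +
      PowerSeries.X ^ N * qPochInf (PowerSeries.X ^ (N + 1)) * h1 + PowerSeries.X ^ N * h2
  · rw [map_mul, constantCoeff_qPochInf]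
    simp [show N ≠ 0 by omega]

/-! ### Lists cut into blocks -/

/-- The lists that consist of successive blocks of lengths `ν 0, …, ν (k - 1)`, where the block of
length `ν i` is weakly increasing with all entries in `[ν i, ν (i + 1)]`; here `ν k` stands
for `m`. -/
def chain : (k : ℕ) → (Fin k → ℕ) → ℕ → Set (List ℕ)
  | 0, _, _ => {[]}
  | k + 1, ν, m =>
    {l | l.take (∑ i, Fin.init ν i) ∈ chain k (Fin.init ν) (ν (Fin.last k)) ∧
      l.drop (∑ i, Fin.init ν i) ∈ box (ν (Fin.last k)) (ν (Fin.last k)) m}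

theorem mem_chain_zero {ν : Fin 0 → ℕ} {m : ℕ} {l : List ℕ} : l ∈ chain 0 ν m ↔ l = [] :=
  Iff.rfl

theorem mem_chain_snoc {k : ℕ} {ν : Fin k → ℕ} {a m : ℕ} {l : List ℕ} :
    l ∈ chain (k + 1) (Fin.snoc ν a : Fin (k + 1) → ℕ) m ↔
      l.take (∑ i, ν i) ∈ chain k ν a ∧ l.drop (∑ i, ν i) ∈ box a a m := by
  simp only [chain, Set.mem_ofPred_eq, Fin.init_snoc, Fin.snoc_last]

theorem sum_snoc {k : ℕ} (ν : Fin k → ℕ) (a : ℕ) :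
    ∑ i, (Fin.snoc ν a : Fin (k + 1) → ℕ) i = ∑ i, ν i + a := by
  simp [Fin.sum_univ_castSucc]

theorem exists_eq_snoc {k : ℕ} (ν : Fin (k + 1) → ℕ) :
    ∃ (ν' : Fin k → ℕ) (a : ℕ), ν = (Fin.snoc ν' a : Fin (k + 1) → ℕ) :=
  ⟨Fin.init ν, ν (Fin.last k), (Fin.snoc_init_self ν).symm⟩

theorem length_of_mem_chain {k : ℕ} {ν : Fin k → ℕ} {m : ℕ} {l : List ℕ}
    (h : l ∈ chain k ν m) : l.length = ∑ i, ν i := by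
  induction k generalizing m l with
  | zero => simp [mem_chain_zero.mp h]
  | succ k ih =>
    obtain ⟨ν, a, rfl⟩ := exists_eq_snoc ν
    rw [mem_chain_snoc] at h
    rw [← List.take_append_drop (∑ i, ν i) l, List.length_append, ih h.1, h.2.2.1, sum_snoc]

theorem le_of_mem_chain {k : ℕ} {ν : Fin k → ℕ} {m : ℕ} {l : List ℕ}
    (h : l ∈ chain k ν m) : ∀ x ∈ l, x ≤ m := by
  induction k generalizing m l with
  | zero => simp [mem_chain_zero.mp h]
  | succ k ih =>
    obtain ⟨ν, a, rfl⟩ := exists_eq_snoc ν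
    rw [mem_chain_snoc] at h
    intro x hx
    rw [← List.take_append_drop (∑ i, ν i) l, List.mem_append] at hx
    rcases hx with hx | hx
    · rcases Nat.eq_zero_or_pos a with rfl | ha
      · have := ih h.1 x hx
        omega
      · obtain ⟨y, hy⟩ := List.exists_mem_of_length_pos (h.2.2.1.symm ▸ ha)
        exact (ih h.1 x hx).trans ((h.2.2.2 y hy).1.trans (h.2.2.2 y hy).2)
    · exact (h.2.2.2 x hx).2

theorem pairwise_of_mem_chain {k : ℕ} {ν : Fin k → ℕ} {m : ℕ} {l : List ℕ}
    (h : l ∈ chain k ν m) : l.Pairwise (· ≤ ·) := by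
  induction k generalizing m l with
  | zero => simp [mem_chain_zero.mp h]
  | succ k ih =>
    obtain ⟨ν, a, rfl⟩ := exists_eq_snoc ν
    rw [mem_chain_snoc] at h
    rw [← List.take_append_drop (∑ i, ν i) l, List.pairwise_append]
    exact ⟨ih h.1, h.2.1, fun x hx y hy => (le_of_mem_chain h.1 x hx).trans (h.2.2.2 y hy).1⟩

theorem monotone_of_mem_chain {k : ℕ} {ν : Fin k → ℕ} {m : ℕ} {l : List ℕ}
    (h : l ∈ chain k ν m) : Monotone (Fin.snoc ν m : Fin (k + 1) → ℕ) := by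
  induction k generalizing m l with
  | zero => exact Fin.monotone_iff_le_succ.mpr fun i => i.elim0
  | succ k ih =>
    obtain ⟨ν, a, rfl⟩ := exists_eq_snoc ν
    rw [mem_chain_snoc] at h
    have ham : a ≤ m := by
      rcases Nat.eq_zero_or_pos a with rfl | ha
      · exact Nat.zero_le m
      · obtain ⟨y, hy⟩ := List.exists_mem_of_length_pos (h.2.2.1.symm ▸ ha)
        exact (h.2.2.2 y hy).1.trans (h.2.2.2 y hy).2
    rw [Fin.monotone_iff_le_succ]
    intro i
    refine Fin.lastCases ?_ (fun i => ?_) i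
    · rw [Fin.succ_last, Fin.snoc_last, Fin.snoc_castSucc, Fin.snoc_last]
      exact ham
    · rw [Fin.succ_castSucc, Fin.snoc_castSucc (α := fun _ => ℕ) m _ i.castSucc,
        Fin.snoc_castSucc (α := fun _ => ℕ) m _ i.succ]
      exact Fin.monotone_iff_le_succ.mp (ih h.1) i

theorem listGF_chain {k : ℕ} (ν : Fin k → ℕ) (m : ℕ) :
    listGF (ind (chain k ν m)) =
      (∏ i : Fin k, qBinom ((Fin.snoc ν m : Fin (k + 1) → ℕ) i.succ)
        ((Fin.snoc ν m : Fin (k + 1) → ℕ) i.castSucc)) *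
      PowerSeries.X ^ (∑ i : Fin k, ν i ^ 2) := by
  induction k generalizing m with
  | zero =>
    rw [show chain 0 ν m = {[]} from rfl, listGF_ind_singleton (by simp)]
    simp
  | succ k ih =>
    obtain ⟨ν, a, rfl⟩ := exists_eq_snoc ν
    have h : ind (chain (k + 1) (Fin.snoc ν a : Fin (k + 1) → ℕ) m) = fun l =>
        ind (chain k ν a) (l.take (∑ i, ν i)) * ind (box a a m) (l.drop (∑ i, ν i)) := by
      funext l
      by_cases h1 : l.take (∑ i, ν i) ∈ chain k ν a
      · rw [ind_of_mem h1, one_mul]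
        exact ind_congr (by simp [mem_chain_snoc, h1])
      · rw [ind_of_notMem h1, zero_mul, ind_of_notMem]
        rw [mem_chain_snoc]
        exact fun h2 => h1 h2.1
    rw [h, listGF_mul fun l hl => length_of_mem_chain (mem_of_ind_ne_zero hl), ih,
      listGF_box_square, Fin.prod_univ_castSucc, Fin.sum_univ_castSucc]
    simp only [Fin.succ_castSucc, Fin.snoc_castSucc, Fin.succ_last, Fin.snoc_last]
    ring

/-- The weight whose generating function is `sptTerm N ν`: the rows in the blocks form a list in
`chain k ν N`, and the rows above them have smallest part `N`, counted with multiplicity. -/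
noncomputable def termWeight {k : ℕ} (N : ℕ) (ν : Fin k → ℕ) (l : List ℕ) : ℚ :=
  ind (chain k ν N) (l.take (∑ i, ν i)) * headCount N (l.drop (∑ i, ν i))

theorem sptTerm_eq_listGF {k : ℕ} {N : ℕ} (hN : 1 ≤ N) (ν : Fin k → ℕ) :
    sptTerm N ν = listGF (termWeight N ν) := by
  have h := listGF_mul (w₁ := ind (chain k ν N)) (w₂ := headCount N)
    fun l hl => length_of_mem_chain (mem_of_ind_ne_zero hl)
  refine Eq.trans ?_ h.symm
  rw [listGF_chain, listGF_headCount hN, sptTerm]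
  ring

/-! ### Blocks and successive lower-Durfee squares -/

theorem le_lowerDurfeeSide_iff {l : List ℕ} {d : ℕ} :
    d ≤ lowerDurfeeSide l ↔ d ≤ l.length ∧ ∀ x ∈ l.take d, d ≤ x := by
  constructor
  · intro h
    have hs : ∀ x ∈ l.take (lowerDurfeeSide l), lowerDurfeeSide l ≤ x :=
      Nat.findGreatest_spec (P := fun d => ∀ x ∈ l.take d, d ≤ x) (Nat.zero_le l.length) (by simp)
    exact ⟨h.trans (Nat.findGreatest_le _),
      fun x hx => h.trans (hs x ((List.take_subset_take_left l h) hx))⟩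
  · rintro ⟨h1, h2⟩
    exact Nat.le_findGreatest h1 h2

theorem rowsAbove_eq_drop (l : List ℕ) (s : ℕ) : rowsAbove l s = l.drop (rowsInSquares l s) := by
  induction s with
  | zero => simp [rowsAbove, rowsInSquares]
  | succ s ih =>
    rw [rowsAbove, rowsInSquares, Finset.sum_range_succ, ← rowsInSquares, ih, List.drop_drop]

theorem rowsInSquares_succ (l : List ℕ) (s : ℕ) :
    rowsInSquares l (s + 1) =
      rowsInSquares l s + lowerDurfeeSide (l.drop (rowsInSquares l s)) := by
  rw [rowsInSquares, Finset.sum_range_succ, ← rowsInSquares, rowsAbove_eq_drop]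

theorem rowsInSquares_le_length (l : List ℕ) (s : ℕ) : rowsInSquares l s ≤ l.length := by
  induction s with
  | zero => simp [rowsInSquares]
  | succ s ih =>
    have h := (le_lowerDurfeeSide_iff.mp (le_refl (lowerDurfeeSide (l.drop (rowsInSquares l s))))).1
    rw [List.length_drop] at h
    rw [rowsInSquares_succ]
    omega

theorem mem_take_drop {l : List ℕ} {s t x : ℕ} :
    x ∈ (l.take s).drop t ↔ ∃ i, ∃ h : i < l.length, t ≤ i ∧ i < s ∧ l[i] = x := by
  rw [List.mem_iff_getElem]
  simp only [List.length_drop, List.length_take, List.getElem_drop, List.getElem_take]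
  constructor
  · rintro ⟨i, hi, rfl⟩
    exact ⟨t + i, by omega, by omega, by omega, rfl⟩
  · rintro ⟨i, hi, h1, h2, rfl⟩
    exact ⟨i - t, by omega, by congr 1; omega⟩

/-- The `s` lowest rows are cut into blocks by a last block of length `a` on top of `t` rows. -/
theorem take_mem_chain_snoc {l : List ℕ} (hl : l.Pairwise (· ≤ ·)) {k : ℕ} {ν : Fin k → ℕ}
    {a m s : ℕ} (hs : s ≤ l.length) (hm : ∀ x ∈ l.take s, x ≤ m) :
    l.take s ∈ chain (k + 1) (Fin.snoc ν a : Fin (k + 1) → ℕ) m ↔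
      ∃ t, t + a = s ∧ l.take t ∈ chain k ν a ∧ ∀ x ∈ (l.take s).drop t, a ≤ x := by
  constructor
  · intro h
    have hlen := length_of_mem_chain h
    rw [List.length_take, min_eq_left hs, sum_snoc] at hlen
    rw [mem_chain_snoc, List.take_take, min_eq_left (by omega)] at h
    exact ⟨_, hlen.symm, h.1, fun x hx => (h.2.2.2 x hx).1⟩
  · rintro ⟨t, rfl, h1, h2⟩
    have hlen := length_of_mem_chain h1
    rw [List.length_take, min_eq_left (by omega)] at hlen
    rw [mem_chain_snoc, ← hlen, List.take_take, min_eq_left (by omega)]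
    refine ⟨h1, (hl.sublist (List.take_sublist _ _)).sublist (List.drop_sublist _ _), ?_,
      fun x hx => ⟨h2 x hx, hm x (List.mem_of_mem_drop hx)⟩⟩
    rw [List.length_drop, List.length_take]
    omega

/-- There is at most one way to cut the `s` lowest rows into blocks: if the last block could have
two different lengths, then the row at the lower end of the longer one would be both too long and
too short. -/
theorem chain_unique {l : List ℕ} (hl : l.Pairwise (· ≤ ·)) {k : ℕ} {ν ν' : Fin k → ℕ} {m s : ℕ}
    (hs : s ≤ l.length) (h : l.take s ∈ chain k ν m) (h' : l.take s ∈ chain k ν' m) : ν = ν' := by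
  induction k generalizing m s with
  | zero => exact Subsingleton.elim _ _
  | succ k ih =>
    have hm := le_of_mem_chain h
    obtain ⟨ν, a, rfl⟩ := exists_eq_snoc ν
    obtain ⟨ν', a', rfl⟩ := exists_eq_snoc ν'
    rw [take_mem_chain_snoc hl hs hm] at h h'
    obtain ⟨t, ht, h1, h2⟩ := h
    obtain ⟨t', ht', h1', h2'⟩ := h'
    have key : ∀ {t t' a a' : ℕ} {ν' : Fin k → ℕ}, t + a = s → t' + a' = s →
        l.take t' ∈ chain k ν' a' → (∀ x ∈ (l.take s).drop t, a ≤ x) → t' ≤ t := by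
      intro t t' a a' ν' ht ht' h1' h2
      by_contra! hlt
      have hx : t < l.length := by omega
      have e1 := h2 l[t] (mem_take_drop.mpr ⟨t, hx, le_rfl, by omega, rfl⟩)
      have e2 := le_of_mem_chain h1' l[t] (by
        rw [← List.drop_zero (l := l.take t')]
        exact mem_take_drop.mpr ⟨t, hx, by omega, hlt, rfl⟩)
      omega
    have htt : t = t' := le_antisymm (key ht' ht h1 h2') (key ht ht' h1' h2)
    obtain rfl : a = a' := by omega
    subst htt
    rw [ih (by omega) h1 h1']

theorem le_rowsInSquares_of_mem_chain {l : List ℕ} (hl : l.Pairwise (· ≤ ·)) {k : ℕ}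
    {ν : Fin k → ℕ} {m s : ℕ} (hs : s ≤ l.length) (h : l.take s ∈ chain k ν m) :
    s ≤ rowsInSquares l k := by
  induction k generalizing m s with
  | zero =>
    have := length_of_mem_chain h
    rw [List.length_take] at this
    simp only [Finset.univ_eq_empty, Finset.sum_empty] at this
    omega
  | succ k ih =>
    have hm := le_of_mem_chain h
    obtain ⟨ν, a, rfl⟩ := exists_eq_snoc ν
    rw [take_mem_chain_snoc hl hs hm] at h
    obtain ⟨t, rfl, h1, h2⟩ := h
    have ht := ih (by omega) h1
    rw [rowsInSquares_succ, ← Nat.sub_le_iff_le_add', le_lowerDurfeeSide_iff, List.length_drop]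
    refine ⟨by omega, fun x hx => ?_⟩
    -- The rows above the first `k` squares and below row `s` belong to the last block, so they
    -- have length at least `a`. There are at most `a` of them, so each is at least as long as
    -- their number.
    rcases le_or_gt (t + a) (rowsInSquares l k) with hle | hlt
    · rw [Nat.sub_eq_zero_of_le hle] at hx
      simp at hx
    · rw [← List.drop_take, mem_take_drop] at hx
      obtain ⟨i, hi, hi1, hi2, rfl⟩ := hx
      have := h2 l[i] (mem_take_drop.mpr ⟨i, hi, by omega, hi2, rfl⟩)
      omega

/-- The `s` lowest rows can be cut into blocks if they lie in the first `k` successive lower-Durfee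
squares: the last block is the longest possible one. -/
theorem exists_mem_chain {l : List ℕ} (hl : l.Pairwise (· ≤ ·)) {k m s : ℕ}
    (hs : s ≤ rowsInSquares l k) (hm : ∀ x ∈ l.take s, x ≤ m) :
    ∃ ν : Fin k → ℕ, l.take s ∈ chain k ν m := by
  induction k generalizing m s with
  | zero =>
    obtain rfl : s = 0 := by simpa [rowsInSquares] using hs
    exact ⟨Fin.elim0, by simp [mem_chain_zero]⟩
  | succ k ih =>
    have hlen := hs.trans (rowsInSquares_le_length l (k + 1))
    have hex : ∃ t, t ≤ s ∧ ∀ x ∈ (l.take s).drop t, s - t ≤ x := ⟨s, le_rfl, by simp⟩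
    classical
    obtain ⟨hts, hblock⟩ := Nat.find_spec hex
    have hmin := fun {t : ℕ} (ht : t < Nat.find hex) => Nat.find_min hex ht
    have hle : Nat.find hex ≤ rowsInSquares l k := by
      rcases le_or_gt s (rowsInSquares l k) with h | h
      · exact hts.trans h
      · refine Nat.find_min' hex ⟨h.le, ?_⟩
        rw [rowsInSquares_succ, ← Nat.sub_le_iff_le_add', le_lowerDurfeeSide_iff,
          ← List.drop_take] at hs
        exact hs.2
    generalize Nat.find hex = t at hts hblock hmin hle
    -- Otherwise the last block could be extended downwards by one row.
    have hbelow : ∀ x ∈ l.take t, x ≤ s - t := by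
      intro x hx
      rw [← List.drop_zero (l := l.take t), mem_take_drop] at hx
      obtain ⟨i, hi, -, hit, rfl⟩ := hx
      by_contra! hlt
      refine hmin (t := t - 1) (by omega) ⟨by omega, fun y hy => ?_⟩
      obtain ⟨i', hi', h1, h2, rfl⟩ := mem_take_drop.mp hy
      have : l[i] ≤ l[i'] := by
        rcases Nat.lt_or_eq_of_le (show i ≤ i' by omega) with h | rfl
        · exact List.pairwise_iff_getElem.mp hl i i' hi hi' h
        · exact le_rfl
      omega
    obtain ⟨ν, hν⟩ := ih hle hbelow
    exact ⟨Fin.snoc ν (s - t), (take_mem_chain_snoc hl hlen hm).mpr ⟨t, by omega, hν, hblock⟩⟩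

/-! ### The sum over all indices -/

theorem termWeight_ne_zero {k N : ℕ} {ν : Fin k → ℕ} {l : List ℕ} (h : termWeight N ν l ≠ 0) :
    l.Pairwise (· ≤ ·) ∧ l.take (∑ i, ν i) ∈ chain k ν N ∧
      ∃ hs : ∑ i, ν i < l.length, l[∑ i, ν i] = N := by
  have h1 := mem_of_ind_ne_zero (left_ne_zero_of_mul h)
  obtain ⟨l', h2, h3⟩ := headCount_ne_zero (right_ne_zero_of_mul h)
  have hs : ∑ i, ν i < l.length := by
    by_contra! hle
    rw [List.drop_eq_nil_of_le hle] at h2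
    exact List.cons_ne_nil _ _ h2.symm
  refine ⟨?_, h1, hs, ?_⟩
  · rw [← List.take_append_drop (∑ i, ν i) l, List.pairwise_append, h2]
    have h4 : N :: l' ∈ sortedGE N := cons_mem_sortedGE.mpr ⟨le_rfl, h3⟩
    exact ⟨pairwise_of_mem_chain h1, h4.1, fun x hx y hy =>
      (le_of_mem_chain h1 x hx).trans (h4.2 y hy)⟩
  · rw [List.drop_eq_getElem_cons hs] at h2
    exact (List.cons.inj h2).1

theorem termWeight_eq_mark {k : ℕ} {ν : Fin k → ℕ} {l : List ℕ} (hl : l.Pairwise (· ≤ ·))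
    (hs : ∑ i, ν i < l.length) (h : l.take (∑ i, ν i) ∈ chain k ν l[∑ i, ν i]) :
    termWeight l[∑ i, ν i] ν l = mark l (∑ i, ν i) := by
  have hd := List.drop_eq_getElem_cons hs
  have hp := hl.sublist (List.drop_sublist (∑ i, ν i) l)
  rw [hd, List.pairwise_cons] at hp
  rw [termWeight, ind_of_mem h, one_mul, mark, List.getD_eq_getElem _ _ hs, hd,
    headCount_cons_self ⟨hp.2, hp.1⟩]

/-- Exactly one index contributes for every row that is counted in `W`, and its contribution is
the mark of that row. -/
theorem hasSum_termWeight {l : List ℕ} (hpos : ∀ x ∈ l, 0 < x) (hl : l.Pairwise (· ≤ ·)) (k : ℕ) :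
    HasSum (fun p : SptIndex k => termWeight p.1.1 p.1.2 l)
      ((∑ i ∈ Finset.range (min (rowsInSquares l k + 1) l.length), mark l i : ℕ) : ℚ) := by
  set T := Finset.range (min (rowsInSquares l k + 1) l.length) with hT
  have hmem : ∀ s : T, s.1 < min (rowsInSquares l k + 1) l.length := fun s =>
    Finset.mem_range.mp s.2
  have hlt : ∀ s : T, s.1 < l.length := fun s => (hmem s).trans_le (min_le_right _ _)
  have hex : ∀ s : T, ∃ ν : Fin k → ℕ, l.take s.1 ∈ chain k ν (l[s.1]'(hlt s)) := by
    intro s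
    have h1 := hmem s
    refine exists_mem_chain hl (by omega) fun x hx => ?_
    rw [← List.drop_zero (l := l.take s.1), mem_take_drop] at hx
    obtain ⟨i, hi, -, his, rfl⟩ := hx
    exact List.pairwise_iff_getElem.mp hl i s.1 hi (hlt s) his
  choose f hf using hex
  have hsum : ∀ s : T, ∑ i, f s i = s.1 := fun s => by
    rw [← length_of_mem_chain (hf s), List.length_take, min_eq_left (hlt s).le]
  have hmono : ∀ s : T, Monotone (f s) := fun s => by
    have h := (monotone_of_mem_chain (hf s)).comp Fin.strictMono_castSucc.monotone
    convert h using 1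
    funext i
    simp
  let g : T → SptIndex k := fun s =>
    ⟨(l[s.1]'(hlt s), f s), hpos _ (List.getElem_mem _), hmono s⟩
  have hval : ∀ s : T, termWeight (g s).1.1 (g s).1.2 l = (mark l s.1 : ℚ) := by
    intro s
    have h := termWeight_eq_mark (ν := f s) hl (by rw [hsum]; exact hlt s)
      (by simpa only [hsum] using hf s)
    simpa only [hsum] using h
  have hg : Function.Injective g := by
    intro s s' h
    have h1 : f s = f s' := congrArg (fun p : SptIndex k => p.1.2) h
    apply Subtype.ext
    rw [← hsum s, ← hsum s', h1]
  have hsupp : ∀ p ∉ Set.range g, termWeight p.1.1 p.1.2 l = 0 := by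
    rintro ⟨⟨N, ν⟩, hN, hν⟩ hp
    by_contra hne
    obtain ⟨-, h1, hs, hN'⟩ := termWeight_ne_zero hne
    dsimp only at h1 hs hN'
    subst hN'
    have hle := le_rowsInSquares_of_mem_chain hl hs.le h1
    let s : T := ⟨∑ i, ν i, by rw [hT, Finset.mem_range]; omega⟩
    exact hp ⟨s, Subtype.ext (Prod.ext rfl (chain_unique hl hs.le (hf s) h1))⟩
  rw [← hg.hasSum_iff hsupp, Nat.cast_sum, ← Finset.sum_coe_sort]
  simp only [Function.comp_def, hval]
  exact hasSum_fintype _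

theorem rows_pos {n : ℕ} (π : n.Partition) : ∀ x ∈ rows π, 0 < x := fun _ hx =>
  π.parts_pos ((Multiset.mem_sort _).mp hx)

theorem rows_pairwise {n : ℕ} (π : n.Partition) : (rows π).Pairwise (· ≤ ·) :=
  Multiset.pairwise_sort _ _

theorem rows_injective {n : ℕ} : Function.Injective (rows : n.Partition → List ℕ) := by
  intro π π' h
  have h1 : ((rows π : List ℕ) : Multiset ℕ) = rows π' := by rw [h]
  rw [rows, rows, Multiset.sort_eq, Multiset.sort_eq] at h1
  exact Nat.Partition.ext h1

/-- Partitions correspond to the sorted lists among all lists of positive integers. -/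
theorem sum_posLists_eq_sum_partition {n : ℕ} {w : List ℕ → ℚ}
    (hw : ∀ l, w l ≠ 0 → l.Pairwise (· ≤ ·)) :
    ∑ l ∈ posLists n, w l = ∑ π : n.Partition, w (rows π) := by
  symm
  refine Finset.sum_of_injOn rows rows_injective.injOn ?_ ?_ fun _ _ => rfl
  · intro π _
    refine Finset.mem_coe.mpr (mem_posLists.mpr ⟨rows_pos π, ?_⟩)
    rw [← Multiset.sum_coe, rows, Multiset.sort_eq, π.parts_sum]
  · intro l hl hr
    by_contra hne
    rw [mem_posLists] at hl
    refine hr ⟨⟨l, fun {i} hi => hl.1 i hi, by simpa using hl.2⟩, Finset.mem_coe.mpr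
      (Finset.mem_univ _), ?_⟩
    refine List.Perm.eq_of_pairwise (le := (· ≤ ·)) (fun a b _ _ => le_antisymm)
      (rows_pairwise _) (hw l hne) ?_
    rw [← Multiset.coe_eq_coe, rows, Multiset.sort_eq]

theorem Spt_eq_sum_W (k n : ℕ) :
    Spt (k + 1) n = ((∑ π : n.Partition, W (k + 1) π : ℕ) : ℚ) := by
  have h : HasSum (fun p : SptIndex k => PowerSeries.coeff n (sptTerm p.1.1 p.1.2))
      (∑ π : n.Partition, (W (k + 1) π : ℚ)) := by
    have h1 : ∀ p : SptIndex k, PowerSeries.coeff n (sptTerm p.1.1 p.1.2) =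
        ∑ π : n.Partition, termWeight p.1.1 p.1.2 (rows π) := fun p => by
      rw [sptTerm_eq_listGF p.2.1, coeff_listGF]
      exact sum_posLists_eq_sum_partition fun l hl => (termWeight_ne_zero hl).1
    simp only [h1]
    exact hasSum_sum fun π _ => hasSum_termWeight (rows_pos π) (rows_pairwise π) k
  rw [Spt, sptSeries, Nat.add_sub_cancel, (summable_sptTerm k).map_tsum _
    (PowerSeries.WithPiTopology.continuous_coeff ℚ n), h.tsum_eq, Nat.cast_sum]

theorem W_one {n : ℕ} (π : n.Partition) : W 1 π = π.parts.count (sInf {x | x ∈ π.parts}) := by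
  have hp : (π.parts : Multiset ℕ) = (rows π : Multiset ℕ) := (Multiset.sort_eq _ _).symm
  have hs := rows_pairwise π
  rw [W, hp]
  generalize rows π = l at hs
  cases l with
  | nil => simp
  | cons x l =>
    rw [List.pairwise_cons] at hs
    have hmin : sInf {y | y ∈ ((x :: l : List ℕ) : Multiset ℕ)} = x := by
      refine IsLeast.csInf_eq ⟨by simp, fun y hy => ?_⟩
      rcases List.mem_cons.mp (Multiset.mem_coe.mp hy) with rfl | hy
      exacts [le_rfl, hs.1 y hy]
    rw [hmin, Multiset.coe_count]
    simp [rowsInSquares, mark]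

end LowerDurfee

theorem theorem3p1 :
    (∀ j : ℕ, 1 ≤ j → ∀ n : ℕ,
      LowerDurfee.Spt j n = ((∑ π : n.Partition, LowerDurfee.W j π : ℕ) : ℚ)) ∧
    ∀ n : ℕ, LowerDurfee.Spt 1 n = (LowerDurfee.spt n : ℚ) := by
  constructor
  · intro j hj n
    obtain ⟨k, rfl⟩ := Nat.exists_eq_add_of_le' hj
    exact LowerDurfee.Spt_eq_sum_W k n
  · intro n
    rw [LowerDurfee.Spt_eq_sum_W 0 n, LowerDurfee.spt]
    simp only [zero_add, LowerDurfee.W_one]
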